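/- A \emph{convex body} in the plane is a compact convex set $s\subset\mathbb{R}^2$ with nonempty interior. It is \emph{$\alpha$-fat} if $\varrho_{\mathrm{out}}(s)/\varrho_{\mathrm{in}}(s)\le\alpha$, where $\varrho_{\mathrm{out}}(s)$ is the radius of a minimum enclosing disk of $s$ and $\varrho_{\mathrm{in}}(s)$ is the radius of a maximum inscribed disk of $s$. The \emph{intersection graph} of a finite set $S$ of convex bodies has vertex set $S$, and two distinct bodies $a,b\in S$ are adjacent if and only if $a\cap b\neq\emptyset$. A \emph{$3$-hop spanner} of a graph $G=(V,E)$ is a subgraph $H$ of $G$ with the same vertex set $V$ such that $d_H(u,v)\le 3\,d_G(u,v)$ for all $u,v\in V$, where $d_H$ and $d_G$ are the unweighted shortest-path distances (with value $\infty$ between different components). Theorem. There is an absolute constant $C>0$ such that for every real number $\alpha$ and every integer $n\ge 0$, the intersection graph of every set of $n$ $\alpha$-fat convex bodies in the plane has a $3$-hop spanner with at most $C\,\alpha^3\, n\log n$ edges (for $n=0$ this bound is read as $0$). That is, it admits a $3$-hop spanner with $O(\alpha^3\, n\log n)$ edges. -/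

import Mathlib

namespace HopSpanner

/-- The Euclidean plane. -/
abbrev Plane : Type := EuclideanSpace ℝ (Fin 2)

/-- A convex body in the plane: a compact convex set with nonempty interior. -/
structure IsConvexBody (s : Set Plane) : Prop where
  isCompact : IsCompact s
  convex : Convex ℝ s
  interior_nonempty : (interior s).Nonempty

/-- The radius of a minimum enclosing disk of `s`. -/
noncomputable def outRadius (s : Set Plane) : ℝ :=
  sInf {r : ℝ | 0 ≤ r ∧ ∃ c : Plane, s ⊆ Metric.closedBall c r}

/-- The radius of a maximum inscribed disk of `s`. -/
noncomputable def inRadius (s : Set Plane) : ℝ :=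
  sSup {r : ℝ | 0 ≤ r ∧ ∃ c : Plane, Metric.closedBall c r ⊆ s}

/-- The fatness of `s`: the ratio between the radii of a minimum enclosing disk and a maximum
inscribed disk. -/
noncomputable def fatness (s : Set Plane) : ℝ :=
  outRadius s / inRadius s

/-- The intersection graph of a finite set `S` of planar sets: the vertices are the members of `S`,
and two distinct members are adjacent iff they have a common point. -/
def intersectionGraph (S : Finset (Set Plane)) : SimpleGraph S where
  Adj a b := a ≠ b ∧ ((a : Set Plane) ∩ (b : Set Plane)).Nonempty
  symm := ⟨fun _ _ h => ⟨h.1.symm, by rw [Set.inter_comm]; exact h.2⟩⟩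
  loopless := ⟨fun _ h => h.1 rfl⟩

/-- `H` is a `t`-hop spanner of `G`: a spanning subgraph in which every hop distance is at most `t`
times the hop distance in `G` (distances are `⊤` between different components). -/
def IsHopSpanner {V : Type*} (t : ℕ) (G H : SimpleGraph V) : Prop :=
  H ≤ G ∧ ∀ u v : V, H.edist u v ≤ (t : ℕ∞) * G.edist u v

end HopSpanner

namespace HopSpanner

/-! Give each body the level `l` of a dyadic grid whose spacing is comparable to its size, so that
it meets at most four cells of that level; the items are body–cell pairs. If `u` meets `v` at `p`
and `u` has the smaller level, the cells at `p` are nested. Fix a cell of level `k`. By fatness, the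
bodies of level at least `k` meeting it are pierced by O(α²) grid points (`exists_gridPoint_mem`).
Bodies sharing a point form a clique, so a star on each such class, plus one edge from each small
body to each class it meets, gives three hops: small body, a neighbour in the class, star centre,
target (`exists_threeHop_of_pierced`). Recursing on a lowest cell that holds a majority of the small
items halves their number (`exists_cover_of_local`), so the depth is O(log n). The total is O(α² n
log n), and α ≥ 1. -/

/-! ### Divide and conquer on nested cells -/

open Finset in
/-- Divide and conquer over a nested family of equivalence relations. A pair `(x, y)` is matched if
`x` has the smaller level and their points agree at the level of `y`. If all pairs around a common
cell can be covered at cost `K` per small item and `1` per large item, then all matched pairs can be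
covered at the cost of an additional logarithmic factor. -/
theorem exists_cover_of_local {X P T : Type*} [DecidableEq T]
    (E : ℤ → Setoid P) (hE : ∀ i j, i ≤ j → ∀ p q, E i p q → E j p q)
    (lev : X → ℤ) (pt : X → P) (G : Set T) (R : X → X → Finset T → Prop)
    (hR : ∀ x y F F', F ⊆ F' → R x y F → R x y F') (K : ℕ)
    (hloc : ∀ (k : ℤ) (z : P) (U A : Finset X),
      (∀ x ∈ U, lev x ≤ k ∧ E k (pt x) z) → (∀ y ∈ A, k ≤ lev y) →
      ∃ F : Finset T, (F : Set T) ⊆ G ∧ F.card ≤ K * U.card + A.card ∧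
        ∀ x ∈ U, ∀ y ∈ A, R x y F)
    (L : ℤ) (z₀ : P) (d : ℕ) :
    ∀ (U A : Finset X), U.card < 2 ^ d → (∀ x ∈ U, lev x ≤ L ∧ E L (pt x) z₀) →
      ∃ F : Finset T, (F : Set T) ⊆ G ∧ F.card ≤ (K * U.card + A.card) * d ∧
        ∀ x ∈ U, ∀ y ∈ A, lev x ≤ lev y → E (lev y) (pt x) (pt y) → R x y F := by
  classical
  induction d with
  | zero =>
    intro U A hU _
    have : U = ∅ := by simpa using hU
    exact ⟨∅, by simp, by simp, by simp [this]⟩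
  | succ d ih =>
    intro U A hU hroot
    rcases U.eq_empty_or_nonempty with rfl | hne
    · exact ⟨∅, by simp, by simp, by simp⟩
    let below : ℤ → P → Finset X := fun k z => {x ∈ U | lev x ≤ k ∧ E k (pt x) z}
    have hpos : 0 < U.card := hne.card_pos
    -- A lowest cell with more than half of `U`: fewer than half lie outside it, and by minimality
    -- no cell of level `k - 1` has a majority.
    obtain ⟨k, ⟨z, hz⟩, hmin⟩ := Int.exists_least_of_bdd
      (P := fun k => ∃ z, U.card < 2 * (below k z).card)
      (by
        refine ⟨U.inf' hne lev, fun k ⟨z, hz⟩ => ?_⟩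
        have : (below k z).Nonempty := by
          rw [← Finset.card_pos]; omega
        obtain ⟨x, hx⟩ := this
        obtain ⟨hxU, hxk, -⟩ := Finset.mem_filter.1 hx
        exact (Finset.inf'_le lev hxU).trans hxk)
      ⟨L, z₀, by
        have : below L z₀ = U := Finset.filter_true_of_mem hroot
        rw [this]; omega⟩
    obtain ⟨F₀, hF₀G, hF₀c, hF₀⟩ := hloc k z (below k z)
      {y ∈ A | k ≤ lev y} (fun x hx => (Finset.mem_filter.1 hx).2)
      (fun y hy => (Finset.mem_filter.1 hy).2)
    -- Subproblems: one per child cell of `z`, and `none` for everything outside `z` or of level at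
    -- least `k`.
    let κ : X → Option (Quotient (E (k - 1))) := fun x =>
      if lev x < k ∧ E k (pt x) z then some ⟦pt x⟧ else none
    -- Items of level exactly `k` in the cell are finished: their partners have level at least `k`,
    -- so `F₀` serves them all. Keeping them would spoil the size bound for `none`.
    let U' : Finset X := {x ∈ U | ¬ (lev x = k ∧ E k (pt x) z)}
    have hsmall : ∀ c, ({x ∈ U' | κ x = c}).card < 2 ^ d := by
      intro c
      rw [pow_succ] at hU
      suffices h : 2 * ({x ∈ U' | κ x = c}).card ≤ U.card by omega
      cases c with
      | none =>
        have hsub : {x ∈ U' | κ x = none} ⊆ U \ below k z := by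
          intro x hx
          simp only [U', κ, below, Finset.mem_filter, Finset.mem_sdiff] at hx ⊢
          obtain ⟨⟨hxU, h1⟩, h2⟩ := hx
          refine ⟨hxU, fun ⟨_, h3, h4⟩ => ?_⟩
          rcases h3.lt_or_eq with h5 | h5
          · rw [if_pos ⟨h5, h4⟩] at h2
            exact absurd h2 (by simp)
          · exact h1 ⟨h5, h4⟩
        have h1 := Finset.card_le_card hsub
        have h2 : (U \ below k z).card + (below k z).card = U.card :=
          Finset.card_sdiff_add_card_eq_card (Finset.filter_subset _ _)
        omega
      | some c =>
        obtain ⟨w, rfl⟩ := Quotient.exists_rep c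
        have hsub : {x ∈ U' | κ x = some ⟦w⟧} ⊆ below (k - 1) w := by
          intro x hx
          simp only [U', κ, below, Finset.mem_filter] at hx ⊢
          obtain ⟨⟨hxU, -⟩, h2⟩ := hx
          split_ifs at h2 with h3
          exact ⟨hxU, by omega, Quotient.exact (Option.some.inj h2)⟩
        have h1 := Finset.card_le_card hsub
        by_contra hcon
        have := hmin (k - 1) ⟨w, by omega⟩
        omega
    choose F hFG hFc hF using fun c => ih {x ∈ U' | κ x = c} {y ∈ A | κ y = c} (hsmall c)
      (fun x hx => hroot x (Finset.mem_filter.1 (Finset.mem_filter.1 hx).1).1)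
    let I : Finset (Option (Quotient (E (k - 1)))) := (U ∪ A).image κ
    refine ⟨F₀ ∪ I.biUnion F, ?_, ?_, ?_⟩
    · intro e he
      simp only [Finset.coe_union, Finset.coe_biUnion, Set.mem_union, Set.mem_iUnion] at he
      rcases he with he | ⟨c, _, he⟩
      · exact hF₀G he
      · exact hFG c he
    · have hUsum : ∑ c ∈ I, ({x ∈ U' | κ x = c}).card = U'.card :=
        (Finset.card_eq_sum_card_fiberwise fun x hx => Finset.mem_coe.2 (Finset.mem_image_of_mem _
          (Finset.mem_union_left _ (Finset.mem_filter.1 hx).1))).symm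
      have hAsum : ∑ c ∈ I, ({y ∈ A | κ y = c}).card = A.card :=
        (Finset.card_eq_sum_card_fiberwise fun x hx => Finset.mem_coe.2 (Finset.mem_image_of_mem _
          (Finset.mem_union_right _ hx))).symm
      have h1 : (I.biUnion F).card ≤ (K * U'.card + A.card) * d := by
        calc (I.biUnion F).card ≤ ∑ c ∈ I, (F c).card := Finset.card_biUnion_le
          _ ≤ ∑ c ∈ I, (K * ({x ∈ U' | κ x = c}).card + ({y ∈ A | κ y = c}).card) * d :=
            Finset.sum_le_sum fun c _ => hFc c
          _ = _ := by rw [← Finset.sum_mul, Finset.sum_add_distrib, ← Finset.mul_sum, hUsum, hAsum]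
      have h2 : U'.card ≤ U.card := Finset.card_filter_le _ _
      have h3 : (below k z).card ≤ U.card := Finset.card_filter_le _ _
      have h4 : ({y ∈ A | k ≤ lev y}).card ≤ A.card := Finset.card_filter_le _ _
      calc (F₀ ∪ I.biUnion F).card ≤ F₀.card + (I.biUnion F).card := Finset.card_union_le _ _
        _ ≤ (K * U.card + A.card) + (K * U.card + A.card) * d := by
          refine add_le_add (hF₀c.trans ?_) (h1.trans ?_) <;> gcongr
        _ = _ := by ring
    · intro x hx y hy hxy hE'
      by_cases hc : (lev x ≤ k ∧ E k (pt x) z) ∧ k ≤ lev y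
      · exact hR _ _ _ _ Finset.subset_union_left
          (hF₀ x (Finset.mem_filter.2 ⟨hx, hc.1⟩) y (Finset.mem_filter.2 ⟨hy, hc.2⟩))
      · have hxU' : x ∈ U' := by
          refine Finset.mem_filter.2 ⟨hx, fun h => hc ⟨⟨h.1.le, h.2⟩, h.1 ▸ hxy⟩⟩
        have hκ : κ x = κ y := by
          by_cases hy' : lev y < k
          · have h1 : E k (pt x) (pt y) := hE _ _ hy'.le _ _ hE'
            by_cases h2 : E k (pt y) z
            · have h3 : E k (pt x) z := (E k).trans h1 h2
              have hx' : κ x = some ⟦pt x⟧ := if_pos ⟨by omega, h3⟩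
              have hy'' : κ y = some ⟦pt y⟧ := if_pos ⟨hy', h2⟩
              rw [hx', hy'']
              exact congrArg some (Quotient.sound (hE _ _ (by omega) _ _ hE'))
            · have h3 : ¬ E k (pt x) z := fun h => h2 ((E k).trans ((E k).symm h1) h)
              have hx' : κ x = none := if_neg fun h => h3 h.2
              have hy'' : κ y = none := if_neg fun h => h2 h.2
              rw [hx', hy'']
          · have hx' : κ x = none := if_neg fun h => hc ⟨⟨h.1.le, h.2⟩, not_lt.1 hy'⟩
            have hy'' : κ y = none := if_neg fun h => hy' h.1
            rw [hx', hy'']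
        refine hR _ _ _ _ ?_ (hF (κ x) x (Finset.mem_filter.2 ⟨hxU', rfl⟩) y
          (Finset.mem_filter.2 ⟨hy, hκ.symm⟩) hxy hE')
        exact (Finset.subset_biUnion_of_mem F (Finset.mem_image_of_mem κ
          (Finset.mem_union_left _ hx))).trans Finset.subset_union_right

/-! ### Norms, radii and fatness -/

theorem abs_coord_le_norm (x : Plane) (m : Fin 2) : |x m| ≤ ‖x‖ := by
  simpa using PiLp.norm_apply_le x m

theorem norm_le_add_abs_coord (x : Plane) : ‖x‖ ≤ |x 0| + |x 1| := by
  rw [EuclideanSpace.norm_eq, Fin.sum_univ_two, Real.sqrt_le_left (by positivity)]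
  simp only [Real.norm_eq_abs]
  nlinarith [abs_nonneg (x 0), abs_nonneg (x 1)]

theorem radius_le_of_closedBall_subset {c c' : Plane} {r R : ℝ} (hr : 0 ≤ r)
    (h : Metric.closedBall c r ⊆ Metric.closedBall c' R) : r ≤ R := by
  let e : Plane := EuclideanSpace.single 0 r
  have he : ‖e‖ = r := by simp [e, abs_of_nonneg hr]
  have h1 : c + e ∈ Metric.closedBall c' R := h (by simp [he])
  have h2 : c - e ∈ Metric.closedBall c' R := h (by simp [he])
  rw [mem_closedBall_iff_norm] at h1 h2
  have h3 : (2 : ℝ) • e = (c + e - c') - (c - e - c') := by rw [two_smul]; abel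
  have h4 := norm_sub_le (c + e - c') (c - e - c')
  rw [← h3, norm_smul, he] at h4
  norm_num at h4
  linarith

/-- Near-optimal disks suffice, losing a factor 2 in each radius; recentring the enclosing disk at
`o` costs another 2, hence the 8. -/
theorem IsConvexBody.exists_balls {s : Set Plane} (hs : IsConvexBody s) {α : ℝ}
    (hα : fatness s ≤ α) :
    1 ≤ α ∧ ∃ (o : Plane) (r : ℝ), 0 < r ∧ Metric.closedBall o r ⊆ s ∧
      s ⊆ Metric.closedBall o (8 * α * r) := by
  obtain ⟨R₀, hR₀⟩ := hs.isCompact.isBounded.subset_closedBall 0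
  obtain ⟨c₁, hc₁⟩ := hs.interior_nonempty
  obtain ⟨ε, hε, hball⟩ := Metric.nhds_basis_closedBall.mem_iff.1 (mem_interior_iff_mem_nhds.1 hc₁)
  have hne : (0 : ℝ) ≤ R₀ := hε.le.trans (radius_le_of_closedBall_subset hε.le (hball.trans hR₀))
  have hbdd : BddAbove {r : ℝ | 0 ≤ r ∧ ∃ c : Plane, Metric.closedBall c r ⊆ s} :=
    ⟨R₀, fun r ⟨hr, c, hc⟩ => radius_le_of_closedBall_subset hr (hc.trans hR₀)⟩
  have hin : 0 < inRadius s := hε.trans_le (le_csSup hbdd ⟨hε.le, c₁, hball⟩)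
  have hio : inRadius s ≤ outRadius s :=
    le_csInf ⟨R₀, hne, 0, hR₀⟩ fun R ⟨_, c, hc⟩ =>
      csSup_le ⟨ε, hε.le, c₁, hball⟩ fun r ⟨hr, c', hc'⟩ =>
        radius_le_of_closedBall_subset hr (hc'.trans hc)
  have hα' : outRadius s ≤ α * inRadius s := (div_le_iff₀ hin).1 hα
  have h1 : 1 ≤ α := by
    by_contra h
    nlinarith
  obtain ⟨r, ⟨hr0, o, ho⟩, hr⟩ := exists_lt_of_lt_csSup
    (s := {r : ℝ | 0 ≤ r ∧ ∃ c : Plane, Metric.closedBall c r ⊆ s}) ⟨ε, hε.le, c₁, hball⟩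
    (show inRadius s / 2 < inRadius s by linarith)
  obtain ⟨R, ⟨hR0, c, hc⟩, hR⟩ := exists_lt_of_csInf_lt
    (s := {r : ℝ | 0 ≤ r ∧ ∃ c : Plane, s ⊆ Metric.closedBall c r}) ⟨R₀, hne, 0, hR₀⟩
    (show outRadius s < 2 * outRadius s by linarith)
  refine ⟨h1, o, r, by linarith, ho, fun p hp => ?_⟩
  have h2 : dist p c ≤ R := hc hp
  have h3 : dist o c ≤ R := hc (ho (Metric.mem_closedBall_self hr0))
  have h4 := dist_triangle_right p o c
  rw [Metric.mem_closedBall]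
  nlinarith

/-! ### Dyadic grids and piercing -/

/-- Two points are in the same cell of the square grid with spacing `2 ^ k` and a vertex at
`(off, off)`. -/
noncomputable def cellSetoid (off : ℝ) (k : ℤ) : Setoid Plane :=
  Setoid.ker fun (p : Plane) (m : Fin 2) => ⌊(p m - off) / (2 : ℝ) ^ k⌋

theorem cellSetoid_iff {off : ℝ} {k : ℤ} {p q : Plane} :
    cellSetoid off k p q ↔ ∀ m, ⌊(p m - off) / (2 : ℝ) ^ k⌋ = ⌊(q m - off) / (2 : ℝ) ^ k⌋ :=
  funext_iff

theorem cellSetoid_mono {off : ℝ} {i j : ℤ} (hij : i ≤ j) {p q : Plane}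
    (h : cellSetoid off i p q) : cellSetoid off j p q := by
  rw [cellSetoid_iff] at h ⊢
  intro m
  obtain ⟨n, rfl⟩ := Int.le.dest hij
  have key : ∀ x : ℝ, ⌊x / (2 : ℝ) ^ (i + (n : ℤ))⌋ = ⌊x / (2 : ℝ) ^ i⌋ / ((2 ^ n : ℕ) : ℤ) := by
    intro x
    rw [zpow_add₀ two_ne_zero, zpow_natCast, ← div_div, ← Int.floor_div_natCast]
    push_cast
    rfl
  rw [key, key, h m]

/-- The point with index `j` in the grid refining by a factor `N` the cell of `z` at level `k`. -/
noncomputable def gridPoint (off : ℝ) (k : ℤ) (N : ℕ) (z : Plane) (j : Fin 2 → ℤ) : Plane :=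
  WithLp.toLp 2 fun m =>
    off + (2 : ℝ) ^ k * (⌊(z m - off) / (2 : ℝ) ^ k⌋ + (j m : ℝ) / N)

/-- A convex set with a large inscribed disk that is not too far from a point of the set in a given
cell contains a point of a fixed finite grid around this cell. -/
theorem exists_gridPoint_mem {v : Set Plane} (hv : Convex ℝ v) {o p z : Plane} {r β off : ℝ}
    {k l : ℤ} {N : ℕ} (hr : 0 < r) (hβ : 0 < β) (hball : Metric.closedBall o r ⊆ v) (hp : p ∈ v)
    (hpo : dist p o ≤ β * r) (hkl : k ≤ l) (hl₁ : 2 * β * r ≤ (2 : ℝ) ^ l)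
    (hl₂ : (2 : ℝ) ^ l ≤ 4 * β * r) (hN : 8 * β ≤ N) (hpz : cellSetoid off k p z) :
    ∃ j ∈ Fintype.piFinset fun _ : Fin 2 => Finset.Icc (-(N : ℤ)) (2 * N),
      gridPoint off k N z j ∈ v := by
  rw [cellSetoid_iff] at hpz
  have hN0 : (0 : ℝ) < N := by linarith
  have hNne : (N : ℝ) ≠ 0 := hN0.ne'
  have hh : (0 : ℝ) < (2 : ℝ) ^ k := by positivity
  have hH : (0 : ℝ) < (2 : ℝ) ^ l := by positivity
  have hhH : (2 : ℝ) ^ k ≤ (2 : ℝ) ^ l := zpow_le_zpow_right₀ one_le_two hkl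
  unfold gridPoint
  generalize (2 : ℝ) ^ k = h at *
  generalize (2 : ℝ) ^ l = H at *
  -- The homothety of ratio `t` centred at `p` maps the inscribed disk to a disk of radius `t * r`
  -- in `v`, by convexity. Its centre `q` is within `h / 2` of `p`, and the mesh `h / N` is at most
  -- `t * r / 2`, so rounding `q` down to the grid stays in that disk.
  set t : ℝ := h / H with ht
  have ht0 : 0 < t := by positivity
  have ht1 : t ≤ 1 := (div_le_one hH).2 hhH
  have htH : t * H = h := div_mul_cancel₀ _ hH.ne'
  set q : Plane := p + t • (o - p) with hq
  have hqp : ∀ m, |q m - p m| ≤ h / 2 := by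
    intro m
    have h1 := abs_coord_le_norm (t • (o - p)) m
    rw [norm_smul, Real.norm_eq_abs, abs_of_pos ht0, ← dist_eq_norm, dist_comm] at h1
    have h2 : t * dist p o ≤ h / 2 := by nlinarith
    have h3 : q m - p m = (t • (o - p)) m := by simp [hq]
    rw [h3]
    exact h1.trans h2
  let a : Fin 2 → ℤ := fun m => ⌊(z m - off) / h⌋
  let j : Fin 2 → ℤ := fun m => ⌊N * ((q m - off) / h - a m)⌋
  have hbd : ∀ m, -(1 / 2 : ℝ) ≤ (q m - off) / h - a m ∧ (q m - off) / h - a m ≤ 3 / 2 := by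
    intro m
    have h1 : (a m : ℝ) ≤ (p m - off) / h := by
      simp only [a]; rw [← hpz m]; exact Int.floor_le _
    have h2 : (p m - off) / h < a m + 1 := by
      simp only [a]; rw [← hpz m]; exact Int.lt_floor_add_one _
    have h3 : (q m - off) / h = (p m - off) / h + (q m - p m) / h := by ring
    have h4 : |(q m - p m) / h| ≤ 1 / 2 := by
      rw [abs_div, abs_of_pos hh, div_le_iff₀ hh]
      linarith [hqp m]
    rw [abs_le] at h4
    constructor <;> linarith
  refine ⟨j, ?_, ?_⟩
  · rw [Fintype.mem_piFinset]
    intro m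
    rw [Finset.mem_Icc]
    obtain ⟨h1, h2⟩ := hbd m
    constructor
    · rw [Int.le_floor]
      push_cast
      nlinarith
    · have : (j m : ℝ) ≤ N * ((q m - off) / h - a m) := Int.floor_le _
      have : (j m : ℝ) ≤ ((2 * N : ℤ) : ℝ) := by
        push_cast
        nlinarith
      exact_mod_cast this
  · set g : Plane := WithLp.toLp 2 fun m => off + h * (a m + (j m : ℝ) / N) with hg
    have hgq : ∀ m, |(g - q) m| ≤ h / N := by
      intro m
      have h1 : (j m : ℝ) ≤ N * ((q m - off) / h - a m) := Int.floor_le _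
      have h2 : N * ((q m - off) / h - a m) < j m + 1 := Int.lt_floor_add_one _
      have h3 : (g - q) m = h / N * (j m - N * ((q m - off) / h - a m)) := by
        simp only [hg, PiLp.sub_apply]
        field_simp
        ring
      rw [h3, abs_mul, abs_of_pos (by positivity : 0 < h / (N : ℝ))]
      refine mul_le_of_le_one_right (by positivity) ?_
      rw [abs_le]
      constructor <;> linarith
    have hnorm : ‖g - q‖ ≤ t * r := by
      have h1 := norm_le_add_abs_coord (g - q)
      have h2 := hgq 0
      have h3 := hgq 1
      have h4 : h / N ≤ t * r / 2 := by
        rw [div_le_iff₀ hN0, ← htH]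
        have : t * r * (8 * β) ≤ t * r * N := by gcongr
        nlinarith
      linarith
    have hmem : o + t⁻¹ • (g - q) ∈ v := by
      apply hball
      rw [mem_closedBall_iff_norm, add_sub_cancel_left, norm_smul, norm_inv, Real.norm_eq_abs,
        abs_of_pos ht0, inv_mul_le_iff₀ ht0]
      exact hnorm
    have hcomb := hv hp hmem (sub_nonneg.2 ht1) ht0.le (by ring)
    have : (1 - t) • p + t • (o + t⁻¹ • (g - q)) = g := by
      rw [smul_add, smul_smul, mul_inv_cancel₀ ht0.ne', one_smul, hq, sub_smul, one_smul, smul_sub]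
      abel
    rwa [this] at hcomb

theorem card_gridIndex (N : ℕ) :
    (Fintype.piFinset fun _ : Fin 2 => Finset.Icc (-(N : ℤ)) (2 * N)).card = (3 * N + 1) ^ 2 := by
  rw [Fintype.card_piFinset_const, Int.card_Icc]
  congr 1
  omega

/-- A point of a set of diameter at most `2 ^ l` is in one of four cells. -/
theorem exists_cell_of_mem {o p : Plane} {ρ off : ℝ} {l : ℤ} (hl : 2 * ρ ≤ (2 : ℝ) ^ l)
    (hp : dist p o ≤ ρ) :
    ∃ e : Fin 2 → Fin 2,
      cellSetoid off l p (WithLp.toLp 2 fun m => o m - ρ + ((e m : ℕ) : ℝ) * (2 : ℝ) ^ l) := by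
  have key : ∀ m : Fin 2, ∃ e : Fin 2, ⌊(p m - off) / (2 : ℝ) ^ l⌋ =
      ⌊(o m - ρ + ((e : ℕ) : ℝ) * (2 : ℝ) ^ l - off) / (2 : ℝ) ^ l⌋ := by
    intro m
    have hH : (0 : ℝ) < (2 : ℝ) ^ l := by positivity
    generalize (2 : ℝ) ^ l = H at *
    have h1 := abs_coord_le_norm (p - o) m
    rw [← dist_eq_norm, PiLp.sub_apply] at h1
    have h2 := abs_le.1 (h1.trans hp)
    have h3 : (o m - ρ - off) / H ≤ (p m - off) / H := by gcongr; linarith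
    have h4 : (p m - off) / H ≤ (o m - ρ - off) / H + 1 := by
      rw [← sub_le_iff_le_add', ← sub_div, div_le_one hH]; linarith
    have h5 := Int.floor_mono h3
    have h6 := Int.floor_mono h4
    rw [Int.floor_add_one] at h6
    rcases h5.eq_or_lt with h7 | h7
    · exact ⟨0, by simp [h7]⟩
    · refine ⟨1, ?_⟩
      have : (o m - ρ + (((1 : Fin 2) : ℕ) : ℝ) * H - off) / H = (o m - ρ - off) / H + 1 := by
        simp; field_simp; ring
      rw [this, Int.floor_add_one]
      omega
  choose e he using key
  exact ⟨e, cellSetoid_iff.2 he⟩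

/-- Finitely many points are in a common cell for a suitable grid position and level. -/
theorem exists_common_cell {X : Type*} [Finite X] (lev : X → ℤ) (pt : X → Plane) :
    ∃ (off : ℝ) (L : ℤ) (z : Plane), ∀ x, lev x ≤ L ∧ cellSetoid off L (pt x) z := by
  obtain ⟨B, hB⟩ := (Set.finite_range fun x => ‖pt x‖).bddAbove
  obtain ⟨M, hM⟩ := (Set.finite_range lev).bddAbove
  obtain ⟨n, hn⟩ := pow_unbounded_of_one_lt (2 * B) (one_lt_two : (1 : ℝ) < 2)
  -- The shift matters: cells with a vertex at the origin never merge points of different quadrants.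
  refine ⟨-B, max M n, WithLp.toLp 2 fun _ => -B, fun x =>
    ⟨(hM ⟨x, rfl⟩).trans (le_max_left _ _), cellSetoid_iff.2 fun m => ?_⟩⟩
  have h1 := abs_le.1 ((abs_coord_le_norm (pt x) m).trans (hB ⟨x, rfl⟩))
  have h2 : (2 : ℝ) ^ n ≤ (2 : ℝ) ^ (max M (n : ℤ)) := by
    rw [← zpow_natCast]
    exact zpow_le_zpow_right₀ one_le_two (le_max_right _ _)
  have h3 : (0 : ℝ) < (2 : ℝ) ^ (max M (n : ℤ)) := by positivity
  have h4 : ⌊(pt x m - -B) / (2 : ℝ) ^ (max M (n : ℤ))⌋ = 0 := by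
    rw [Int.floor_eq_zero_iff]
    exact ⟨div_nonneg (by linarith) h3.le, (div_lt_one h3).2 (by linarith)⟩
  rw [h4]
  simp

/-! ### Three-hop connections -/

/-- Two vertices are joined by at most three edges of `F`, where loops are allowed. -/
def ThreeHop {V : Type*} (F : Finset (Sym2 V)) (u v : V) : Prop :=
  ∃ b c, s(u, b) ∈ F ∧ s(b, c) ∈ F ∧ s(c, v) ∈ F

theorem ThreeHop.mono {V : Type*} {F F' : Finset (Sym2 V)} (h : F ⊆ F') {u v : V}
    (huv : ThreeHop F u v) : ThreeHop F' u v := by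
  obtain ⟨b, c, h1, h2, h3⟩ := huv
  exact ⟨b, c, h h1, h h2, h h3⟩

theorem ThreeHop.symm {V : Type*} {F : Finset (Sym2 V)} {u v : V}
    (huv : ThreeHop F u v) : ThreeHop F v u := by
  obtain ⟨b, c, h1, h2, h3⟩ := huv
  exact ⟨c, b, by rwa [Sym2.eq_swap], by rwa [Sym2.eq_swap], by rwa [Sym2.eq_swap]⟩

theorem edist_fromEdgeSet_le_one {V : Type*} {F : Set (Sym2 V)} {a b : V} (h : s(a, b) ∈ F) :
    (SimpleGraph.fromEdgeSet F).edist a b ≤ 1 := by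
  by_cases hab : a = b
  · simp [hab]
  · exact (SimpleGraph.edist_eq_one_iff_adj.2 ((SimpleGraph.fromEdgeSet_adj F).2 ⟨h, hab⟩)).le

theorem ThreeHop.edist_le {V : Type*} {F : Finset (Sym2 V)} {u v : V} (h : ThreeHop F u v) :
    (SimpleGraph.fromEdgeSet (F : Set (Sym2 V))).edist u v ≤ 3 := by
  obtain ⟨b, c, h1, h2, h3⟩ := h
  calc _ ≤ _ := SimpleGraph.edist_triangle (v := b)
    _ ≤ 1 + (1 + 1) := add_le_add (edist_fromEdgeSet_le_one (Finset.mem_coe.2 h1))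
        (SimpleGraph.edist_triangle.trans
          (add_le_add (edist_fromEdgeSet_le_one (Finset.mem_coe.2 h2))
            (edist_fromEdgeSet_le_one (Finset.mem_coe.2 h3))))
    _ = 3 := by norm_num

theorem isHopSpanner_of_adj {V : Type*} {t : ℕ} {G H : SimpleGraph V} (ht : t ≠ 0) (hle : H ≤ G)
    (hadj : ∀ u v, G.Adj u v → H.edist u v ≤ t) : IsHopSpanner t G H := by
  refine ⟨hle, fun u v => ?_⟩
  have key : ∀ {u v : V} (p : G.Walk u v), H.edist u v ≤ (t : ℕ∞) * p.length := by
    intro u v p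
    induction p with
    | nil => simp
    | cons h p ih =>
      refine SimpleGraph.edist_triangle.trans ((add_le_add (hadj _ _ h) ih).trans ?_)
      rw [SimpleGraph.Walk.length_cons]
      push_cast
      rw [mul_add, mul_one, add_comm]
  by_cases h : G.Reachable u v
  · obtain ⟨p, hp⟩ := h.exists_walk_length_eq_edist
    rw [← hp]
    exact key p
  · rw [SimpleGraph.edist_eq_top_of_not_reachable h]
    rw [ENat.mul_top (by exact_mod_cast ht)]
    exact le_top

/-- If the sets of a family `A` are pierced by the points `g j`, `j ∈ J`, then stars centred at one
set per point, together with an edge from each set of `U` to one set per point, connect all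
intersecting pairs by three hops. -/
theorem exists_threeHop_of_pierced {V X ι Q : Type*} [DecidableEq V] (body : V → Set Q) (b : X → V)
    (g : ι → Q) (J : Finset ι) (U A : Finset X)
    (hA : ∀ y ∈ A, ∃ j ∈ J, g j ∈ body (b y)) (hne : ∀ v, (body v).Nonempty) :
    ∃ F : Finset (Sym2 V),
      (F : Set (Sym2 V)) ⊆ {e | ∃ u v, e = s(u, v) ∧ (body u ∩ body v).Nonempty} ∧
      F.card ≤ J.card * U.card + A.card ∧
      ∀ x ∈ U, ∀ y ∈ A, (body (b x) ∩ body (b y)).Nonempty → ThreeHop F (b x) (b y) := by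
  classical
  rcases A.eq_empty_or_nonempty with rfl | ⟨y₀, hy₀⟩
  · exact ⟨∅, by simp, by simp, by simp⟩
  have : Nonempty ι := ⟨(hA y₀ hy₀).choose⟩
  choose! idx hidx hg using hA
  have hcen : ∀ j, ∃ c : V, (∃ y ∈ A, idx y = j) → ∃ y ∈ A, idx y = j ∧ b y = c := fun j => by
    by_cases h : ∃ y ∈ A, idx y = j
    · obtain ⟨y, hy, hj⟩ := h
      exact ⟨b y, fun _ => ⟨y, hy, hj, rfl⟩⟩
    · exact ⟨b y₀, fun h' => absurd h' h⟩
  choose cen hcen using hcen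
  have hpick : ∀ x j, ∃ c : V, (body (b x) ∩ body c).Nonempty ∧
      ((∃ y ∈ A, idx y = j ∧ (body (b x) ∩ body (b y)).Nonempty) →
        ∃ y ∈ A, idx y = j ∧ b y = c) := fun x j => by
    by_cases h : ∃ y ∈ A, idx y = j ∧ (body (b x) ∩ body (b y)).Nonempty
    · obtain ⟨y, hy, hj, hn⟩ := h
      exact ⟨b y, hn, fun _ => ⟨y, hy, hj, rfl⟩⟩
    -- With no neighbour in the class, the default is a harmless loop.
    · exact ⟨b x, by rw [Set.inter_self]; exact hne _, fun h' => absurd h' h⟩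
  choose pick hpick₁ hpick₂ using hpick
  refine ⟨(J ×ˢ U).image (fun q => s(b q.2, pick q.2 q.1)) ∪
    A.image (fun y => s(b y, cen (idx y))), ?_, ?_, ?_⟩
  · intro e he
    rw [Finset.mem_coe, Finset.mem_union, Finset.mem_image, Finset.mem_image] at he
    rcases he with ⟨q, -, rfl⟩ | ⟨y, hy, rfl⟩
    · exact ⟨_, _, rfl, hpick₁ _ _⟩
    · obtain ⟨y', hy', hj, hc⟩ := hcen (idx y) ⟨y, hy, rfl⟩
      exact ⟨_, _, rfl, g (idx y), hg y hy, by rw [← hc, ← hj]; exact hg y' hy'⟩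
  · refine (Finset.card_union_le _ _).trans (add_le_add ?_ Finset.card_image_le)
    exact Finset.card_image_le.trans (Finset.card_product _ _).le
  · intro x hx y hy hxy
    obtain ⟨y', hy', hj, hc⟩ := hpick₂ x (idx y) ⟨y, hy, rfl, hxy⟩
    refine ⟨pick x (idx y), cen (idx y), Finset.mem_union_left _ ?_,
      Finset.mem_union_right _ ?_, Finset.mem_union_right _ ?_⟩
    · exact Finset.mem_image.2 ⟨(idx y, x), Finset.mem_product.2 ⟨hidx y hy, hx⟩, rfl⟩
    · exact Finset.mem_image.2 ⟨y', hy', by rw [hj, hc]⟩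
    · rw [Sym2.eq_swap]
      exact Finset.mem_image_of_mem (fun y => s(b y, cen (idx y))) hy

/-! ### Assembly and constants -/

/-- The combinatorial form of the spanner bound: `N` controls the fatness, and `2 ^ d` exceeds four
times the number of bodies. -/
theorem exists_hopSpanner_of_balls (S : Finset (Set Plane)) (hS : ∀ s ∈ S, IsConvexBody s)
    {β : ℝ} (hβ : 0 < β) {N d : ℕ} (hN : 8 * β ≤ N) (hd : 4 * S.card < 2 ^ d)
    (o : S → Plane) (r : S → ℝ) (hr : ∀ s, 0 < r s)
    (hin : ∀ s : S, Metric.closedBall (o s) (r s) ⊆ s)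
    (hout : ∀ s : S, (s : Set Plane) ⊆ Metric.closedBall (o s) (β * r s)) :
    ∃ H : SimpleGraph S, IsHopSpanner 3 (intersectionGraph S) H ∧
      H.edgeSet.ncard ≤ ((3 * N + 1) ^ 2 + 1) * (4 * S.card) * d := by
  classical
  have hlev : ∀ s, ∃ l : ℤ, 2 * β * r s ≤ (2 : ℝ) ^ l ∧ (2 : ℝ) ^ l ≤ 4 * β * r s := fun s => by
    have hpos : 0 < 2 * β * r s := by have := hr s; positivity
    obtain ⟨n, hn₁, hn₂⟩ := exists_mem_Ioc_zpow hpos (one_lt_two : (1 : ℝ) < 2)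
    refine ⟨n + 1, hn₂, ?_⟩
    rw [zpow_add_one₀ two_ne_zero]
    linarith
  choose l hl₁ hl₂ using hlev
  let pt : S × (Fin 2 → Fin 2) → Plane := fun x =>
    WithLp.toLp 2 fun m => o x.1 m - β * r x.1 + ((x.2 m : ℕ) : ℝ) * (2 : ℝ) ^ l x.1
  have hcell : ∀ (off : ℝ) (s : S), ∀ p ∈ (s : Set Plane), ∃ e,
      cellSetoid off (l s) p (pt (s, e)) := fun off s p hp =>
    exists_cell_of_mem (by linarith [hl₁ s]) (hout s hp)
  obtain ⟨off, L, z₀, hroot⟩ := exists_common_cell (fun x : S × (Fin 2 → Fin 2) => l x.1) pt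
  let R : S × (Fin 2 → Fin 2) → S × (Fin 2 → Fin 2) → Finset (Sym2 S) → Prop := fun x y F =>
    ((x.1 : Set Plane) ∩ y.1 ∩ {p | cellSetoid off (l x.1) p (pt x)}).Nonempty →
      ThreeHop F x.1 y.1
  have hnonempty : ∀ s : S, (s : Set Plane).Nonempty := fun s =>
    ⟨o s, hin s (Metric.mem_closedBall_self (hr s).le)⟩
  have hcard : (Finset.univ : Finset (S × (Fin 2 → Fin 2))).card = 4 * S.card := by
    simp [mul_comm]
  obtain ⟨F, hFG, hFc, hF⟩ := exists_cover_of_local (cellSetoid off)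
    (fun i j hij p q h => cellSetoid_mono hij h) (fun x : S × (Fin 2 → Fin 2) => l x.1) pt
    {e : Sym2 S | ∃ u v : S, e = s(u, v) ∧ ((u : Set Plane) ∩ v).Nonempty} R
    (fun x y F F' hsub h hn => (h hn).mono hsub) ((3 * N + 1) ^ 2)
    (by
      intro k z U A hU hA
      -- For the other `y`, `R x y` is vacuous, as the cell of `x` lies in that of `z`.
      let A' := {y ∈ A | ((y.1 : Set Plane) ∩ {p | cellSetoid off k p z}).Nonempty}
      obtain ⟨F, hFG, hFc, hF⟩ := exists_threeHop_of_pierced (fun s : S => (s : Set Plane))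
        (Prod.fst : S × (Fin 2 → Fin 2) → S) (gridPoint off k N z)
        (Fintype.piFinset fun _ : Fin 2 => Finset.Icc (-(N : ℤ)) (2 * N)) U A'
        (by
          intro y hy
          obtain ⟨hyA, p, hp, hpz⟩ := Finset.mem_filter.1 hy
          exact exists_gridPoint_mem (hS _ y.1.2).convex (hr y.1) hβ (hin y.1) hp (hout y.1 hp)
            (hA y hyA) (hl₁ y.1) (hl₂ y.1) hN hpz)
        hnonempty
      refine ⟨F, hFG, ?_, ?_⟩
      · rw [card_gridIndex] at hFc
        exact hFc.trans (Nat.add_le_add_left (Finset.card_filter_le _ _) _)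
      · rintro x hx y hy ⟨p, ⟨hpx, hpy⟩, hpc⟩
        obtain ⟨hxk, hxz⟩ := hU x hx
        exact hF x hx y (Finset.mem_filter.2 ⟨hy, p, hpy,
          (cellSetoid off k).trans (cellSetoid_mono hxk hpc) hxz⟩) ⟨p, hpx, hpy⟩)
    L z₀ d Finset.univ Finset.univ (by rwa [hcard]) (fun x _ => hroot x)
  have hpair : ∀ u v : S, l u ≤ l v → ((u : Set Plane) ∩ v).Nonempty → ThreeHop F u v := by
    rintro u v huv ⟨p, hpu, hpv⟩
    obtain ⟨e, he⟩ := hcell off u p hpu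
    obtain ⟨e', he'⟩ := hcell off v p hpv
    exact hF (u, e) (Finset.mem_univ _) (v, e') (Finset.mem_univ _) huv
      ((cellSetoid off (l v)).trans ((cellSetoid off (l v)).symm (cellSetoid_mono huv he)) he')
      ⟨p, ⟨hpu, hpv⟩, he⟩
  refine ⟨SimpleGraph.fromEdgeSet (F : Set (Sym2 S)), isHopSpanner_of_adj three_ne_zero ?_ ?_, ?_⟩
  · intro a b hab
    obtain ⟨hF', hne⟩ := (SimpleGraph.fromEdgeSet_adj _).1 hab
    refine ⟨hne, ?_⟩
    obtain ⟨u, v, heq, hn⟩ := hFG hF'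
    rcases Sym2.eq_iff.1 heq with ⟨rfl, rfl⟩ | ⟨rfl, rfl⟩
    · exact hn
    · rwa [Set.inter_comm]
  · intro u v huv
    rcases le_total (l u) (l v) with h | h
    · exact (hpair u v h huv.2).edist_le
    · exact (hpair v u h (by rw [Set.inter_comm]; exact huv.2)).symm.edist_le
  · rw [SimpleGraph.edgeSet_fromEdgeSet]
    calc _ ≤ (F : Set (Sym2 S)).ncard := Set.ncard_le_ncard Set.sdiff_subset F.finite_toSet
      _ = F.card := Set.ncard_coe_finset F
      _ ≤ _ := hFc
      _ = _ := by rw [hcard]; ring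

end HopSpanner

theorem theorem5 :
    ∃ C : ℝ, 0 < C ∧
      ∀ (α : ℝ) (n : ℕ) (S : Finset (Set HopSpanner.Plane)),
        S.card = n →
        (∀ s ∈ S, HopSpanner.IsConvexBody s ∧ HopSpanner.fatness s ≤ α) →
        ∃ H : SimpleGraph S,
          HopSpanner.IsHopSpanner 3 (HopSpanner.intersectionGraph S) H ∧
          (H.edgeSet.ncard : ℝ) ≤ C * α ^ 3 * (n : ℝ) * Real.log (n : ℝ) := by
  refine ⟨1300000, by norm_num, fun α n S hn hS => ?_⟩
  -- Here the bound is 0, so the spanner must be edgeless.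
  rcases Nat.lt_or_ge n 2 with hn2 | hn2
  · have hsub : Subsingleton S := Finset.card_le_one_iff_subsingleton_coe.1 (by omega)
    refine ⟨⊥, HopSpanner.isHopSpanner_of_adj three_ne_zero bot_le
      fun u v h => absurd (Subsingleton.elim u v) h.ne, ?_⟩
    interval_cases n <;> simp
  · obtain ⟨s₀, hs₀⟩ : S.Nonempty := Finset.card_pos.1 (by omega)
    have hα : 1 ≤ α := ((hS s₀ hs₀).1.exists_balls (hS s₀ hs₀).2).1
    choose o r hr hin hout using fun s : S =>
      ((hS s s.2).1.exists_balls (hS s s.2).2).2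
    have hN : 8 * (8 * α) ≤ (⌈64 * α⌉₊ : ℝ) := by
      have := Nat.le_ceil (64 * α)
      linarith
    have hN' : (⌈64 * α⌉₊ : ℝ) ≤ 65 * α := by
      have := Nat.ceil_lt_add_one (show 0 ≤ 64 * α by linarith)
      linarith
    generalize ⌈64 * α⌉₊ = N at hN hN'
    set d : ℕ := Nat.log 2 (4 * S.card) + 1 with hd
    obtain ⟨H, hH, hHc⟩ := HopSpanner.exists_hopSpanner_of_balls S (fun s hs => (hS s hs).1)
      (show 0 < 8 * α by linarith) hN (Nat.lt_pow_succ_log_self one_lt_two _ : _ < 2 ^ d)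
      o r hr hin hout
    refine ⟨H, hH, ?_⟩
    replace hHc : H.edgeSet.ncard ≤ ((3 * N + 1) ^ 2 + 1) * (4 * S.card) * d := hHc
    rw [hn] at hHc hd
    have hn0 : (0 : ℝ) < n := by positivity
    have hn2' : (2 : ℝ) ≤ n := by exact_mod_cast hn2
    -- From `2 ^ d ≤ 8 * n` and `2 ≤ n`, `d * log 2 ≤ 4 * log n`, and `log 2 > 1 / 2`.
    have hlog : (d : ℝ) ≤ 8 * Real.log n := by
      have h1 : 2 ^ d ≤ 8 * n := by
        have := Nat.pow_log_le_self 2 (show 4 * n ≠ 0 by omega)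
        rw [hd, pow_succ]
        omega
      have h2 : ((2 : ℝ) ^ d) ≤ 8 * n := by exact_mod_cast h1
      have h3 := Real.log_le_log (by positivity) h2
      rw [Real.log_pow, Real.log_mul (by norm_num) hn0.ne',
        show (8 : ℝ) = 2 ^ 3 by norm_num, Real.log_pow] at h3
      have h4 := Real.log_le_log two_pos hn2'
      have h5 := Real.log_two_gt_d9
      push_cast at h3
      nlinarith [Nat.cast_nonneg (α := ℝ) d]
    have hK : ((3 * N + 1 : ℝ) ^ 2 + 1) ≤ 38417 * α ^ 3 := by
      have h1 : (3 * N + 1 : ℝ) ≤ 196 * α := by linarith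
      have h2 : (3 * N + 1 : ℝ) ^ 2 ≤ (196 * α) ^ 2 := by gcongr
      have h3 : α ^ 2 ≤ α ^ 3 := pow_le_pow_right₀ hα (by norm_num)
      nlinarith [one_le_pow₀ hα (n := 3)]
    have hlog0 : 0 ≤ Real.log n := Real.log_nonneg (by linarith)
    calc (H.edgeSet.ncard : ℝ) ≤ (((3 * N + 1) ^ 2 + 1) * (4 * n) * d : ℕ) := by exact_mod_cast hHc
      _ = ((3 * N + 1 : ℝ) ^ 2 + 1) * (4 * n) * d := by push_cast; ring
      _ ≤ (38417 * α ^ 3) * (4 * n) * (8 * Real.log n) := by gcongr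
      _ = 1229344 * (α ^ 3 * n * Real.log n) := by ring
      _ ≤ 1300000 * (α ^ 3 * n * Real.log n) := by gcongr; norm_num
      _ = _ := by ring
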